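/- Let $\mathbb F$ be a field of characteristic zero. Let $W_{xy,z}$ be the $\mathbb F[x,y]$-module whose underlying vector space is $\mathbb F[x,y,z]$, with $x\cdot f=\partial f/\partial x$ and $y\cdot f=\partial f/\partial y$. A linear automorphism of $\mathbb F[x,y]$ is an $\mathbb F$-algebra automorphism $\theta$ with $\theta(x)=\alpha_{11}x+\alpha_{12}y$ and $\theta(y)=\alpha_{21}x+\alpha_{22}y$ for some $\alpha_{ij}\in\mathbb F$ with $\det[\alpha_{ij}]\neq 0$; for an $\mathbb F[x,y]$-module $V$, the twisted module $V_\theta$ is the additive group $V$ on which $f$ acts as $\theta(f)$ acts on $V$. Two $\mathbb F[x,y]$-modules $V$ and $W$ are weakly isomorphic if $W\cong V_\theta$ for some linear automorphism $\theta$. Then the problem of classifying finite-dimensional submodules of $W_{xy,z}$ up to weak isomorphism is wild, that is, it contains the problem of classifying pairs of square matrices of the same size up to similarity $(A,B)\mapsto(S^{-1}AS,S^{-1}BS)$. Explicitly: there are an integer $d\ge 0$, two $d\times d$ matrices $P,Q$ whose entries are noncommutative polynomials over $\mathbb F$ in two variables, and a map $\Phi$ from the pairs $(A,B)$ of $n\times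 n$ matrices over $\mathbb F$ (for all $n\ge 0$) to the finite-dimensional submodules of $W_{xy,z}$, such that 1. for every pair $(A,B)$, the operators of multiplication by $x$ and by $y$ on $\Phi(A,B)$ have, in some $\mathbb F$-basis of $\Phi(A,B)$, the matrices $P(A,B)$ and $Q(A,B)$ (the $dn\times dn$ block matrices obtained by substituting $A,B$ for the variables in the entries of $P,Q$); 2. for all pairs $(A,B)$ and $(A',B')$, of any sizes, $\Phi(A,B)$ and $\Phi(A',B')$ are weakly isomorphic if and only if $(A,B)$ and $(A',B')$ have the same size and are similar. -/

import Mathlib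

open MvPolynomial

noncomputable section

namespace WeakIsoWild

universe u v

/-! ### The algebra `F[x, y]`, linear automorphisms and twisted modules -/

/-- The polynomial algebra `F[x, y]`, with `x = X 0` and `y = X 1`. -/
abbrev PolyXY (F : Type u) [Field F] : Type u := MvPolynomial (Fin 2) F

section Twist

variable {F : Type u} [Field F]

/-- An automorphism `θ` of `F[x, y]` is linear if `θ x = α₁₁ x + α₁₂ y` and
`θ y = α₂₁ x + α₂₂ y` for some `α` with `det α ≠ 0`. -/
def IsLinearAut (θ : PolyXY F ≃ₐ[F] PolyXY F) : Prop :=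
  ∃ α : Matrix (Fin 2) (Fin 2) F, α.det ≠ 0 ∧
    ∀ i, θ (X i) = C (α i 0) * X 0 + C (α i 1) * X 1

/-- The twisted module `V_θ`: the additive group of `V`, on which `f` acts as `θ f` acts on `V`. -/
def Twist (_θ : PolyXY F ≃ₐ[F] PolyXY F) (V : Type v) : Type v := V

instance (θ : PolyXY F ≃ₐ[F] PolyXY F) (V : Type v) [AddCommGroup V] :
    AddCommGroup (Twist θ V) := inferInstanceAs (AddCommGroup V)

instance (θ : PolyXY F ≃ₐ[F] PolyXY F) (V : Type v) [AddCommGroup V] [Module (PolyXY F) V] :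
    Module (PolyXY F) (Twist θ V) :=
  Module.compHom V (θ : PolyXY F →+* PolyXY F)

/-- The identity map of the underlying additive groups, from `V` to `V_θ`. -/
def toTwist (θ : PolyXY F ≃ₐ[F] PolyXY F) (V : Type v) [AddCommGroup V] : V ≃+ Twist θ V :=
  AddEquiv.refl V

theorem smul_toTwist (θ : PolyXY F ≃ₐ[F] PolyXY F) {V : Type v} [AddCommGroup V]
    [Module (PolyXY F) V] (f : PolyXY F) (v : V) :
    f • toTwist θ V v = toTwist θ V (θ f • v) := rfl

theorem toTwist_symm_smul (θ : PolyXY F ≃ₐ[F] PolyXY F) {V : Type v} [AddCommGroup V]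
    [Module (PolyXY F) V] (f : PolyXY F) (v : Twist θ V) :
    (toTwist θ V).symm (f • v) = θ f • (toTwist θ V).symm v := rfl

/-- Two `F[x, y]`-modules `V` and `W` are weakly isomorphic if `W` is isomorphic to `V_θ` for
some linear automorphism `θ`. -/
def WeaklyIsomorphic (F : Type u) [Field F] (V W : Type v)
    [AddCommGroup V] [Module (PolyXY F) V] [AddCommGroup W] [Module (PolyXY F) W] : Prop :=
  ∃ θ : PolyXY F ≃ₐ[F] PolyXY F, IsLinearAut θ ∧ Nonempty (W ≃ₗ[PolyXY F] Twist θ V)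

theorem isLinearAut_refl : IsLinearAut (AlgEquiv.refl : PolyXY F ≃ₐ[F] PolyXY F) :=
  ⟨1, by simp, by simp [Fin.forall_fin_two]⟩

theorem IsLinearAut.trans {θ η : PolyXY F ≃ₐ[F] PolyXY F} (hθ : IsLinearAut θ)
    (hη : IsLinearAut η) : IsLinearAut (θ.trans η) := by
  obtain ⟨α, hα, h⟩ := hθ
  obtain ⟨β, hβ, k⟩ := hη
  refine ⟨α * β, by simp [hα, hβ], fun i => ?_⟩
  have hC : ∀ a : F, η (C a) = C a := fun a => η.commutes a
  simp only [AlgEquiv.trans_apply, h, map_add, map_mul, hC, k, Matrix.mul_apply,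
    Fin.sum_univ_two]
  ring

theorem IsLinearAut.symm {θ : PolyXY F ≃ₐ[F] PolyXY F} (hθ : IsLinearAut θ) :
    IsLinearAut θ.symm := by
  obtain ⟨α, hα, h⟩ := hθ
  have hu : IsUnit α.det := isUnit_iff_ne_zero.mpr hα
  refine ⟨α⁻¹, ?_, fun i => ?_⟩
  · rw [Matrix.det_nonsing_inv]
    simpa using hα
  · apply θ.injective
    have hC : ∀ a : F, θ (C a) = C a := fun a => θ.commutes a
    have hm := Matrix.nonsing_inv_mul α hu
    have h0 := congrArg (fun M : Matrix (Fin 2) (Fin 2) F => (C (M i 0) : PolyXY F)) hm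
    have h1 := congrArg (fun M : Matrix (Fin 2) (Fin 2) F => (C (M i 1) : PolyXY F)) hm
    simp only [Matrix.mul_apply, Fin.sum_univ_two, map_add, map_mul] at h0 h1
    have key : (X i : PolyXY F) = C ((1 : Matrix (Fin 2) (Fin 2) F) i 0) * X 0
        + C ((1 : Matrix (Fin 2) (Fin 2) F) i 1) * X 1 := by
      revert i
      simp [Fin.forall_fin_two]
    simp only [AlgEquiv.apply_symm_apply, map_add, map_mul, hC, h]
    rw [key, ← h0, ← h1]
    ring

theorem WeaklyIsomorphic.refl (V : Type v) [AddCommGroup V] [Module (PolyXY F) V] :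
    WeaklyIsomorphic F V V :=
  ⟨AlgEquiv.refl, isLinearAut_refl,
    ⟨{ toTwist AlgEquiv.refl V with map_smul' := fun _ _ => rfl }⟩⟩

theorem WeaklyIsomorphic.symm {V W : Type v}
    [AddCommGroup V] [Module (PolyXY F) V] [AddCommGroup W] [Module (PolyXY F) W]
    (h : WeaklyIsomorphic F V W) : WeaklyIsomorphic F W V := by
  obtain ⟨θ, hθ, ⟨e⟩⟩ := h
  refine ⟨θ.symm, hθ.symm,
    ⟨{ (toTwist θ V).trans (e.symm.toAddEquiv.trans (toTwist θ.symm W)) with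
        map_smul' := fun f v => ?_ }⟩⟩
  change toTwist θ.symm W (e.symm (toTwist θ V (f • v)))
    = f • toTwist θ.symm W (e.symm (toTwist θ V v))
  rw [smul_toTwist, ← map_smul, smul_toTwist, AlgEquiv.apply_symm_apply]

theorem WeaklyIsomorphic.trans {U V W : Type v} [AddCommGroup U] [Module (PolyXY F) U]
    [AddCommGroup V] [Module (PolyXY F) V] [AddCommGroup W] [Module (PolyXY F) W]
    (h : WeaklyIsomorphic F U V) (k : WeaklyIsomorphic F V W) : WeaklyIsomorphic F U W := by
  obtain ⟨θ, hθ, ⟨e⟩⟩ := h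
  obtain ⟨η, hη, ⟨e'⟩⟩ := k
  refine ⟨η.trans θ, hη.trans hθ,
    ⟨{ e'.toAddEquiv.trans ((toTwist η V).symm.trans (e.toAddEquiv.trans
        ((toTwist θ U).symm.trans (toTwist (η.trans θ) U)))) with
        map_smul' := fun f v => ?_ }⟩⟩
  change toTwist (η.trans θ) U ((toTwist θ U).symm (e ((toTwist η V).symm (e' (f • v)))))
    = f • toTwist (η.trans θ) U ((toTwist θ U).symm (e ((toTwist η V).symm (e' v))))
  rw [map_smul, toTwist_symm_smul, map_smul, toTwist_symm_smul, smul_toTwist]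
  rfl

end Twist

/-! ### The universal module `W_{xy,z}` -/

section Universal

variable (F : Type u) [Field F]

/-- The vector space underlying `W_{xy,z}`: polynomials in `x = X 0`, `y = X 1`, `z = X 2`. -/
def UniversalModule : Type u := MvPolynomial (Fin 3) F

instance : AddCommGroup (UniversalModule F) :=
  inferInstanceAs (AddCommGroup (MvPolynomial (Fin 3) F))

instance : Module F (UniversalModule F) :=
  inferInstanceAs (Module F (MvPolynomial (Fin 3) F))

/-- The operator `∂/∂x` on `F[x, y, z]`. -/
def dX : Module.End F (UniversalModule F) :=
  (pderiv (0 : Fin 3) : Derivation F (MvPolynomial (Fin 3) F) (MvPolynomial (Fin 3) F)).toLinearMap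

/-- The operator `∂/∂y` on `F[x, y, z]`. -/
def dY : Module.End F (UniversalModule F) :=
  (pderiv (1 : Fin 3) : Derivation F (MvPolynomial (Fin 3) F) (MvPolynomial (Fin 3) F)).toLinearMap

theorem commute_dX_dY : Commute (dX F) (dY F) := by
  have h : ⁅(pderiv 0 : Derivation F (MvPolynomial (Fin 3) F) (MvPolynomial (Fin 3) F)),
      (pderiv 1 : Derivation F (MvPolynomial (Fin 3) F) (MvPolynomial (Fin 3) F))⁆ = 0 := by
    apply MvPolynomial.derivation_ext
    intro i
    rw [Derivation.commutator_apply]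
    fin_cases i <;> simp [pderiv_X]
  refine LinearMap.ext fun p => ?_
  have hp := DFunLike.congr_fun h (show MvPolynomial (Fin 3) F from p)
  rw [Derivation.commutator_apply] at hp
  exact sub_eq_zero.mp hp

/-- The action of `F[x, y]` on `W_{xy,z}`: the algebra homomorphism to the endomorphisms that
sends the monomial `x ^ i * y ^ j` to `(∂/∂x) ^ i * (∂/∂y) ^ j`. -/
def universalAction : PolyXY F →ₐ[F] Module.End F (UniversalModule F) :=
  AddMonoidAlgebra.lift F (Module.End F (UniversalModule F)) (Fin 2 →₀ ℕ)
    { toFun := fun m => dX F ^ (m.toAdd 0) * dY F ^ (m.toAdd 1)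
      map_one' := by simp
      map_mul' := fun m n => by
        have h := ((commute_dX_dY F).pow_pow (n.toAdd 0) (m.toAdd 1)).eq
        simp only [toAdd_mul, Finsupp.add_apply, pow_add]
        rw [mul_assoc, mul_assoc, ← mul_assoc (dX F ^ _) (dY F ^ _) (dY F ^ _), h]
        simp only [mul_assoc] }

/-- `W_{xy,z}` as an `F[x, y]`-module. -/
instance : Module (PolyXY F) (UniversalModule F) :=
  Module.compHom (UniversalModule F) (universalAction F).toRingHom

theorem smul_eq_universalAction (f : PolyXY F) (w : UniversalModule F) :
    f • w = universalAction F f w := rfl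

theorem X_zero_smul (w : UniversalModule F) : (X 0 : PolyXY F) • w = dX F w := by
  rw [smul_eq_universalAction]
  have : universalAction F (X 0) = dX F := by
    refine (AddMonoidAlgebra.lift_single _ _ _).trans ?_
    simp
  rw [this]

theorem X_one_smul (w : UniversalModule F) : (X 1 : PolyXY F) • w = dY F w := by
  rw [smul_eq_universalAction]
  have : universalAction F (X 1) = dY F := by
    refine (AddMonoidAlgebra.lift_single _ _ _).trans ?_
    simp
  rw [this]

instance : IsScalarTower F (PolyXY F) (UniversalModule F) where
  smul_assoc a f w := by
    rw [smul_eq_universalAction, smul_eq_universalAction, map_smul, LinearMap.smul_apply]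

/-- The finite-dimensional submodules of `W_{xy,z}`. -/
def FinDimSubmodule : Type u :=
  {U : Submodule (PolyXY F) (UniversalModule F) // FiniteDimensional F U}

/-- Weak isomorphism of finite-dimensional submodules of `W_{xy,z}`. -/
def weakIsoSetoid : Setoid (FinDimSubmodule F) where
  r U V := WeaklyIsomorphic F U.1 V.1
  iseqv :=
    { refl := fun U => WeaklyIsomorphic.refl U.1
      symm := fun h => h.symm
      trans := fun h k => h.trans k }

variable {F}

/-- `S` and `T` are the matrices of the operators "multiplication by `x`" and "multiplication by
`y`" on the submodule `U` in some basis of `U` over `F`. -/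
def FinDimSubmodule.HasMatrices (U : FinDimSubmodule F) (ι : Type) [Fintype ι]
    (S T : Matrix ι ι F) : Prop :=
  ∃ b : Module.Basis ι F U.1, ∀ j,
    (X 0 : PolyXY F) • b j = ∑ i, S i j • b i ∧
    (X 1 : PolyXY F) • b j = ∑ i, T i j • b i

end Universal

/-! ### Wildness -/

section Wild

variable (F : Type u) [Field F]

/-- Pairs of square matrices of the same (arbitrary) size over `F`. -/
structure MatrixPair where
  size : ℕ
  fst : Matrix (Fin size) (Fin size) F
  snd : Matrix (Fin size) (Fin size) F

variable {F}

/-- Similarity of matrix pairs: `(A, B)` is similar exactly to the pairs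
`(S⁻¹ * A * S, S⁻¹ * B * S)` with `S` nonsingular (so similar pairs have the same size). -/
inductive SimilarPairs : MatrixPair F → MatrixPair F → Prop
  | conj (n : ℕ) (A B S : Matrix (Fin n) (Fin n) F) (hS : IsUnit S) :
      SimilarPairs ⟨n, A, B⟩ ⟨n, S⁻¹ * A * S, S⁻¹ * B * S⟩

/-- The value `P(A, B)` of a `d × d` matrix `P` of noncommutative polynomials in two variables at
a pair `(A, B)` of `n × n` matrices: the block matrix with the `n × n` blocks `P i j (A, B)`. -/
def evalAt {d : ℕ} (P : Matrix (Fin d) (Fin d) (FreeAlgebra F (Fin 2))) (p : MatrixPair F) :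
    Matrix (Fin d × Fin p.size) (Fin d × Fin p.size) F :=
  Matrix.of fun r c => FreeAlgebra.lift F ![p.fst, p.snd] (P r.1 c.1) r.2 c.2

/-- Let a classification problem be given by a type `Obj` of objects, an equivalence relation `r`
on it, and the relation `hasMatrices` saying which pairs of square matrices represent an object.
The problem is wild if it contains the problem of classifying pairs of square matrices up to
similarity: there are matrices `P`, `Q` of noncommutative polynomials in two variables such that
each matrix pair `p` gives an object represented by `(P(p), Q(p))`, and two matrix pairs are
similar if and only if the objects they give are equivalent. -/
def IsWild {Obj : Type v} (r : Setoid Obj)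
    (hasMatrices : Obj → (ι : Type) → [Fintype ι] → Matrix ι ι F → Matrix ι ι F → Prop) : Prop :=
  ∃ (d : ℕ) (P Q : Matrix (Fin d) (Fin d) (FreeAlgebra F (Fin 2))) (Φ : MatrixPair F → Obj),
    (∀ p, hasMatrices (Φ p) (Fin d × Fin p.size) (evalAt P p) (evalAt Q p)) ∧
    ∀ p q, r (Φ p) (Φ q) ↔ SimilarPairs p q

end Wild

end WeakIsoWild

end

/-!
A submodule of `W_{xy,z}` may be any finite-dimensional module on which `x` and `y` act nilpotently:
for commuting nilpotent matrices `S`, `T` the map sending `v` to the sum of the polynomials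
`(S ^ i * T ^ j * v)_r * x ^ i * y ^ j * z ^ r / (i! * j!)` is injective and turns `S`, `T` into
`∂/∂x`, `∂/∂y` (`exists_hasMatrices`; here the characteristic is used). So it is enough to
attach to each matrix pair `(A, B)`, acting on `V = F ^ n`, a finite-dimensional nilpotent module
`M(A, B)` that remembers the pair up to similarity.

Let `M(A, B)` be the quotient of `V ⊗ F[x, y]` by everything of degree at least `7` and by the
relations, in degree `6`,
`x ^ 5 * y • v = 0`, `x ^ 2 * y ^ 4 • v = x * y ^ 5 • v`,
`x ^ 3 * y ^ 3 • v = x * y ^ 5 • A v` and `x ^ 4 * y ^ 2 • v = x * y ^ 5 • B v`.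
It is the direct sum of copies of `V` labelled by the monomials of degree less than `6` and by
`x ^ 6`, `y ^ 6`, `x * y ^ 5`; the action of a monomial is a block matrix over the free algebra in
`A` and `B` (`mulMatrix`).

A semilinear isomorphism `φ` from `M(A', B')` to `M(A, B)`, twisted by a linear automorphism `θ`,
induces a bijection `g` of the spaces `V` of generators, that is, of the quotients of the modules
by the multiples of `x` and `y`. On elements of degree `6` it acts through `g` and `θ` alone. The
relation `x ^ 5 * y = 0` together with the freeness of `x ^ 6` and `y ^ 6` forces
`θ(x) ^ 5 * θ(y)` to have no terms in `x ^ 6` and `y ^ 6`, so that `θ` is diagonal or antidiagonal;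
antidiagonal is impossible since `x * y ^ 5` does not vanish, and then
`x ^ 2 * y ^ 4 = x * y ^ 5` makes `θ` scalar (`scalar_of_semilinear`). A scalar `θ` multiplies the
last two relations by one common constant, which cancels, so `g A' = A g` and `g B' = B g`
(`genMap_mulVec`). Conversely, a matrix intertwining two pairs acts blockwise as an isomorphism of
modules (`nonempty_linearEquiv_of_conj`).
-/

noncomputable section

namespace WeakIsoWild

universe u v

/-! ### The block matrices -/

/-- The monomials `x ^ i * y ^ j`, encoded as `(i, j)`, that serve as normal forms: all those of
degree less than `6`, and `x ^ 6`, `y ^ 6`, `x * y ^ 5` in degree `6`. -/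
def basisMonomials : Finset (ℕ × ℕ) :=
  {m ∈ Finset.range 7 ×ˢ Finset.range 7 |
    m.1 + m.2 < 6 ∨ m = (6, 0) ∨ m = (0, 6) ∨ m = (1, 5)}

theorem mem_basisMonomials {m : ℕ × ℕ} : m ∈ basisMonomials ↔
    m.1 + m.2 < 6 ∨ m = (6, 0) ∨ m = (0, 6) ∨ m = (1, 5) := by
  simp only [basisMonomials, Finset.mem_filter, Finset.mem_product, Finset.mem_range]
  refine ⟨fun h => h.2, fun h => ⟨?_, h⟩⟩
  rcases h with h | rfl | rfl | rfl
  · omega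
  all_goals simp

/-- The number of basis monomials, which label the rows and columns of the block matrices. -/
abbrev numBlocks : ℕ := basisMonomials.card

/-- The monomial that labels a block. -/
def mon (c : Fin numBlocks) : ℕ × ℕ := (basisMonomials.equivFin.symm c).1

/-- The block labelled by a basis monomial. -/
def blk (m : ℕ × ℕ) (hm : m ∈ basisMonomials) : Fin numBlocks := basisMonomials.equivFin ⟨m, hm⟩

theorem mon_mem (c : Fin numBlocks) : mon c ∈ basisMonomials :=
  (basisMonomials.equivFin.symm c).2

theorem mon_injective : Function.Injective mon :=
  Subtype.val_injective.comp basisMonomials.equivFin.symm.injective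

@[simp]
theorem mon_blk (m : ℕ × ℕ) (hm : m ∈ basisMonomials) : mon (blk m hm) = m := by
  simp [mon, blk]

/-- The block of the constant monomial. -/
abbrev blkOne : Fin numBlocks := blk (0, 0) (by simp [mem_basisMonomials])

/-- The block of the monomial `x ^ 6`. -/
abbrev blkX : Fin numBlocks := blk (6, 0) (by simp [mem_basisMonomials])

/-- The block of the monomial `y ^ 6`. -/
abbrev blkY : Fin numBlocks := blk (0, 6) (by simp [mem_basisMonomials])

/-- The block of the monomial `x * y ^ 5`. -/
abbrev blkXY : Fin numBlocks := blk (1, 5) (by simp [mem_basisMonomials])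

section NormalForm

variable (F : Type u) [Field F]

/-- The coefficient of the monomial `c` in the normal form of the monomial `m`. A basis monomial
is its own normal form, `x ^ 2 * y ^ 4`, `x ^ 3 * y ^ 3`, `x ^ 4 * y ^ 2` are respectively `1`,
`a`, `b` times `x * y ^ 5` (where `a`, `b` are the free variables), and all other monomials
vanish. -/
def normalForm (c m : ℕ × ℕ) : FreeAlgebra F (Fin 2) :=
  if m = c then 1 else if c = (1, 5) then
    if m = (2, 4) then 1 else if m = (3, 3) then FreeAlgebra.ι F 0
    else if m = (4, 2) then FreeAlgebra.ι F 1 else 0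
  else 0

variable {F}

theorem normalForm_of_mem (c : ℕ × ℕ) {m : ℕ × ℕ} (hm : m ∈ basisMonomials) :
    normalForm F c m = if m = c then 1 else 0 := by
  rw [mem_basisMonomials] at hm
  have h1 : m ≠ (2, 4) := by rintro rfl; simp at hm
  have h2 : m ≠ (3, 3) := by rintro rfl; simp at hm
  have h3 : m ≠ (4, 2) := by rintro rfl; simp at hm
  simp [normalForm, h1, h2, h3]

theorem normalForm_eq_zero_of_degree {c : ℕ × ℕ} (hc : c ∈ basisMonomials) {m : ℕ × ℕ}
    (hm : 7 ≤ m.1 + m.2) : normalForm F c m = 0 := by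
  rw [mem_basisMonomials] at hc
  have h0 : m ≠ c := by
    rintro rfl
    rcases hc with h | h | h | h
    · omega
    all_goals (rw [h] at hm; simp at hm)
  have h1 : m ≠ (2, 4) := by rintro rfl; simp at hm
  have h2 : m ≠ (3, 3) := by rintro rfl; simp at hm
  have h3 : m ≠ (4, 2) := by rintro rfl; simp at hm
  simp [normalForm, h0, h1, h2, h3]

/-- Away from the block of `x * y ^ 5`, nothing but `c` itself reduces to `c`. -/
theorem normalForm_of_ne {c m : ℕ × ℕ} (hc : c ≠ (1, 5)) (h : m ≠ c) :
    normalForm F c m = 0 := by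
  simp [normalForm, hc, h]

theorem normalForm_five_one {c : ℕ × ℕ} (hc : c ∈ basisMonomials) :
    normalForm F c (5, 1) = 0 := by
  have h0 : (5, 1) ≠ c := by rintro rfl; simp [mem_basisMonomials] at hc
  simp [normalForm, h0]

/-- Normal forms may be taken before multiplying by a monomial `s` of positive degree. -/
theorem sum_normalForm_mul (c : Fin numBlocks) (m s : ℕ × ℕ) (hs : 1 ≤ s.1 + s.2) :
    ∑ c', normalForm F (mon c) (mon c' + s) * normalForm F (mon c') m
      = normalForm F (mon c) (m + s) := by
  by_cases hm : m ∈ basisMonomials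
  · rw [Finset.sum_eq_single (blk m hm)]
    · simp [normalForm]
    · intro c' _ hc'
      rw [normalForm_of_mem _ hm, if_neg, mul_zero]
      rintro rfl
      exact hc' (mon_injective (by simp))
    · simp
  -- All monomials of degree less than `6` are basis monomials, so both sides vanish by degree.
  · have hdeg : 6 ≤ m.1 + m.2 := by
      by_contra h
      exact hm (mem_basisMonomials.2 (Or.inl (by omega)))
    rw [normalForm_eq_zero_of_degree (mon_mem c) (by simp only [Prod.fst_add, Prod.snd_add]; omega)]
    refine Finset.sum_eq_zero fun c' _ => ?_
    have hne : m ≠ mon c' := fun h => hm (h ▸ mon_mem c')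
    by_cases hc' : mon c' = (1, 5)
    · rw [hc', normalForm_eq_zero_of_degree (mon_mem c), zero_mul]
      simp only [Prod.fst_add, Prod.snd_add]
      omega
    · rw [normalForm_of_ne hc' hne, mul_zero]

variable (F)

/-- Multiplication by the monomial `s` on normal forms, as a block matrix. -/
def mulMatrix (s : ℕ × ℕ) : Matrix (Fin numBlocks) (Fin numBlocks) (FreeAlgebra F (Fin 2)) :=
  Matrix.of fun c c' => normalForm F (mon c) (mon c' + s)

variable {F}

theorem mulMatrix_mul (s t : ℕ × ℕ) (hs : 1 ≤ s.1 + s.2) :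
    mulMatrix F s * mulMatrix F t = mulMatrix F (t + s) := by
  ext c c' : 2
  simp only [Matrix.mul_apply, mulMatrix, Matrix.of_apply]
  rw [sum_normalForm_mul _ _ _ hs, add_assoc]

theorem mulMatrix_pow_succ (s : ℕ × ℕ) (hs : 1 ≤ s.1 + s.2) (k : ℕ) :
    mulMatrix F s ^ (k + 1) = mulMatrix F ((k + 1) • s) := by
  induction k with
  | zero => simp
  | succ k ih => rw [pow_succ', ih, mulMatrix_mul _ _ hs, succ_nsmul _ (k + 1)]

theorem mulMatrix_pow_seven (s : ℕ × ℕ) (hs : 1 ≤ s.1 + s.2) : mulMatrix F s ^ 7 = 0 := by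
  rw [mulMatrix_pow_succ s hs]
  ext c c' : 2
  refine normalForm_eq_zero_of_degree (mon_mem c) ?_
  simp only [Prod.fst_add, Prod.snd_add, Prod.smul_fst, Prod.smul_snd, smul_eq_mul]
  omega

theorem commute_mulMatrix (s t : ℕ × ℕ) (hs : 1 ≤ s.1 + s.2) (ht : 1 ≤ t.1 + t.2) :
    Commute (mulMatrix F s) (mulMatrix F t) := by
  rw [Commute, SemiconjBy, mulMatrix_mul _ _ hs, mulMatrix_mul _ _ ht, add_comm]

theorem evalAt_mul {d : ℕ} (P Q : Matrix (Fin d) (Fin d) (FreeAlgebra F (Fin 2)))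
    (p : MatrixPair F) : evalAt (P * Q) p = evalAt P p * evalAt Q p := by
  ext ⟨c, k⟩ ⟨c', k'⟩
  simp only [evalAt, Matrix.of_apply, Matrix.mul_apply, map_sum, map_mul, Matrix.sum_apply,
    Fintype.sum_prod_type]

theorem evalAt_one {d : ℕ} (p : MatrixPair F) :
    evalAt (1 : Matrix (Fin d) (Fin d) (FreeAlgebra F (Fin 2))) p = 1 := by
  ext ⟨c, k⟩ ⟨c', k'⟩
  by_cases h : c = c' <;> simp [evalAt, Matrix.one_apply, h]

theorem evalAt_pow {d : ℕ} (P : Matrix (Fin d) (Fin d) (FreeAlgebra F (Fin 2)))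
    (p : MatrixPair F) (k : ℕ) : evalAt (P ^ k) p = evalAt P p ^ k := by
  induction k with
  | zero => simp [evalAt_one]
  | succ k ih => rw [pow_succ, evalAt_mul, ih, pow_succ]

theorem evalAt_mulMatrix_pow_seven (s : ℕ × ℕ) (hs : 1 ≤ s.1 + s.2) (p : MatrixPair F) :
    evalAt (mulMatrix F s) p ^ 7 = 0 := by
  rw [← evalAt_pow, mulMatrix_pow_seven s hs]
  ext
  simp [evalAt]

theorem commute_evalAt_mulMatrix (s t : ℕ × ℕ) (hs : 1 ≤ s.1 + s.2) (ht : 1 ≤ t.1 + t.2)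
    (p : MatrixPair F) : Commute (evalAt (mulMatrix F s) p) (evalAt (mulMatrix F t) p) := by
  rw [Commute, SemiconjBy, ← evalAt_mul, ← evalAt_mul, (commute_mulMatrix s t hs ht).eq]

end NormalForm

/-! ### Commuting nilpotent matrices act on submodules of the universal module -/

section Embedding

variable {F : Type u} [Field F]

theorem C_smul_eq {U : Type v} [AddCommGroup U] [Module F U] [Module (PolyXY F) U]
    [IsScalarTower F (PolyXY F) U] (a : F) (w : U) : (C a : PolyXY F) • w = a • w :=
  algebraMap_smul (PolyXY F) a w

variable {κ : Type} [Fintype κ]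

/-- The exponent of `x ^ i * y ^ j * z ^ r`, with the elements `r` of `κ` numbered. -/
def expo (i j : ℕ) (r : κ) : Fin 3 →₀ ℕ :=
  Finsupp.single 0 i + Finsupp.single 1 j + Finsupp.single 2 (Fintype.equivFin κ r : ℕ)

theorem expo_inj {i j i' j' : ℕ} {r r' : κ} :
    expo i j r = expo i' j' r' ↔ i = i' ∧ j = j' ∧ r = r' := by
  refine ⟨fun h => ?_, by rintro ⟨rfl, rfl, rfl⟩; rfl⟩
  have h0 := DFunLike.congr_fun h 0
  have h1 := DFunLike.congr_fun h 1
  have h2 := DFunLike.congr_fun h 2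
  simp [expo] at h0 h1 h2
  exact ⟨h0, h1, (Fintype.equivFin κ).injective (Fin.ext h2)⟩

variable [DecidableEq κ]

/-- One term of `embed`. -/
def embedTerm (S T : Matrix κ κ F) (i j : ℕ) (r : κ) : (κ → F) →ₗ[F] MvPolynomial (Fin 3) F :=
  (monomial (expo i j r)).comp
    (((i.factorial * j.factorial : F)⁻¹) • (LinearMap.proj r).comp (S ^ i * T ^ j).mulVecLin)

theorem embedTerm_apply (S T : Matrix κ κ F) (i j : ℕ) (r : κ) (v : κ → F) :
    embedTerm S T i j r v = monomial (expo i j r)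
      ((i.factorial * j.factorial : F)⁻¹ * ((S ^ i * T ^ j).mulVec v) r) := rfl

/-- The map that sends a vector `v` to the polynomial whose coefficient at `x ^ i * y ^ j * z ^ r`
is the `r`-th coordinate of `S ^ i * T ^ j * v / (i! * j!)`. -/
def embed (N : ℕ) (S T : Matrix κ κ F) : (κ → F) →ₗ[F] UniversalModule F :=
  (∑ r : κ, ∑ i ∈ Finset.range N, ∑ j ∈ Finset.range N, embedTerm S T i j r :
    (κ → F) →ₗ[F] MvPolynomial (Fin 3) F)

theorem embed_apply (N : ℕ) (S T : Matrix κ κ F) (v : κ → F) : embed N S T v =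
    (∑ r : κ, ∑ i ∈ Finset.range N, ∑ j ∈ Finset.range N, embedTerm S T i j r v :
      MvPolynomial (Fin 3) F) := by
  change (∑ r : κ, ∑ i ∈ Finset.range N, ∑ j ∈ Finset.range N, embedTerm S T i j r :
    (κ → F) →ₗ[F] MvPolynomial (Fin 3) F) v = _
  simp only [LinearMap.sum_apply]

theorem embed_injective {N : ℕ} (hN : 0 < N) (S T : Matrix κ κ F) :
    Function.Injective (embed N S T) := by
  rw [injective_iff_map_eq_zero]
  intro v hv
  ext r
  have h : coeff (expo 0 0 r) (embed N S T v : MvPolynomial (Fin 3) F) = 0 := by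
    rw [hv]
    exact coeff_zero _
  rw [embed_apply] at h
  simp only [coeff_sum, embedTerm_apply, coeff_monomial, expo_inj] at h
  rw [Finset.sum_eq_single r, Finset.sum_eq_single 0, Finset.sum_eq_single 0] at h
  · simpa using h
  all_goals simp +contextual [hN]

variable [CharZero F]

theorem pderiv_embedTerm_zero (S T : Matrix κ κ F) (j : ℕ) (r : κ) (v : κ → F) :
    pderiv 0 (embedTerm S T 0 j r v) = 0 := by
  simp [embedTerm_apply, pderiv_monomial, expo]

theorem pderiv_embedTerm_succ {S T : Matrix κ κ F} (hST : Commute S T) (i j : ℕ) (r : κ)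
    (v : κ → F) :
    pderiv 0 (embedTerm S T (i + 1) j r v) = embedTerm S T i j r (S.mulVec v) := by
  have h1 : expo (i + 1) j r - Finsupp.single 0 1 = expo i j r := by
    ext k; fin_cases k <;> simp [expo]
  have h2 : expo (i + 1) j r 0 = i + 1 := by simp [expo]
  have h3 : (i + 1 : F) ≠ 0 := by exact_mod_cast Nat.succ_ne_zero i
  have h4 : S ^ (i + 1) * T ^ j = S ^ i * T ^ j * S := by
    rw [pow_succ, mul_assoc, mul_assoc, (hST.pow_right j).eq]
  rw [embedTerm_apply, pderiv_monomial, h1, h2, embedTerm_apply, h4, Matrix.mulVec_mulVec]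
  congr 1
  rw [Nat.factorial_succ]
  push_cast
  field_simp

theorem pderiv_one_embedTerm_zero (S T : Matrix κ κ F) (i : ℕ) (r : κ) (v : κ → F) :
    pderiv 1 (embedTerm S T i 0 r v) = 0 := by
  simp [embedTerm_apply, pderiv_monomial, expo]

theorem pderiv_one_embedTerm_succ {S T : Matrix κ κ F} (i j : ℕ) (r : κ) (v : κ → F) :
    pderiv 1 (embedTerm S T i (j + 1) r v) = embedTerm S T i j r (T.mulVec v) := by
  have h1 : expo i (j + 1) r - Finsupp.single 1 1 = expo i j r := by
    ext k; fin_cases k <;> simp [expo]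
  have h2 : expo i (j + 1) r 1 = j + 1 := by simp [expo]
  have h3 : (j + 1 : F) ≠ 0 := by exact_mod_cast Nat.succ_ne_zero j
  have h4 : S ^ i * T ^ (j + 1) = S ^ i * T ^ j * T := by rw [pow_succ, mul_assoc]
  rw [embedTerm_apply, pderiv_monomial, h1, h2, embedTerm_apply, h4, Matrix.mulVec_mulVec]
  congr 1
  rw [Nat.factorial_succ]
  push_cast
  field_simp

theorem dX_embed {N : ℕ} {S T : Matrix κ κ F} (hST : Commute S T) (hS : S ^ (N + 1) = 0)
    (v : κ → F) : dX F (embed (N + 1) S T v) = embed (N + 1) S T (S.mulVec v) := by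
  rw [embed_apply, embed_apply]
  change pderiv 0 _ = _
  simp only [map_sum]
  refine Finset.sum_congr rfl fun r _ => ?_
  rw [Finset.sum_range_succ',
    Finset.sum_range_succ fun i => ∑ j ∈ Finset.range (N + 1), embedTerm S T i j r (S.mulVec v)]
  congr 1
  · exact Finset.sum_congr rfl fun i _ => Finset.sum_congr rfl fun j _ =>
      pderiv_embedTerm_succ hST i j r v
  · rw [Finset.sum_eq_zero fun j _ => pderiv_embedTerm_zero S T j r v,
      Finset.sum_eq_zero fun j _ => ?_]
    rw [embedTerm_apply, Matrix.mulVec_mulVec, mul_assoc, ← (hST.pow_right j).eq, ← mul_assoc,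
      ← pow_succ, hS]
    simp

theorem dY_embed {N : ℕ} {S T : Matrix κ κ F} (hT : T ^ (N + 1) = 0)
    (v : κ → F) : dY F (embed (N + 1) S T v) = embed (N + 1) S T (T.mulVec v) := by
  rw [embed_apply, embed_apply]
  change pderiv 1 _ = _
  simp only [map_sum]
  refine Finset.sum_congr rfl fun r _ => Finset.sum_congr rfl fun i _ => ?_
  rw [Finset.sum_range_succ', Finset.sum_range_succ _ N]
  congr 1
  · exact Finset.sum_congr rfl fun j _ => pderiv_one_embedTerm_succ i j r v
  · rw [pderiv_one_embedTerm_zero, embedTerm_apply, Matrix.mulVec_mulVec, mul_assoc, ← pow_succ, hT]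
    simp

/-- Every pair of commuting nilpotent matrices is the action of `x` and `y` on some
finite-dimensional submodule of `W_{xy,z}`. -/
theorem exists_hasMatrices {N : ℕ} {S T : Matrix κ κ F} (hST : Commute S T)
    (hS : S ^ (N + 1) = 0) (hT : T ^ (N + 1) = 0) :
    ∃ U : FinDimSubmodule F, U.HasMatrices κ S T := by
  set E := embed (N + 1) S T with hE
  have hX : ∀ v, (X 0 : PolyXY F) • E v = E (S.mulVec v) := fun v => by
    rw [X_zero_smul, hE, dX_embed hST hS]
  have hY : ∀ v, (X 1 : PolyXY F) • E v = E (T.mulVec v) := fun v => by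
    rw [X_one_smul, hE, dY_embed hT]
  let U : Submodule (PolyXY F) (UniversalModule F) :=
    { (LinearMap.range E).toAddSubmonoid with
      smul_mem' := by
        intro f w hw
        change f • w ∈ LinearMap.range E
        replace hw : w ∈ LinearMap.range E := hw
        induction f using MvPolynomial.induction_on generalizing w with
        | C a => rw [C_smul_eq]; exact Submodule.smul_mem _ _ hw
        | add f g hf hg => rw [add_smul]; exact add_mem (hf hw) (hg hw)
        | mul_X f i hf =>
          rw [mul_smul]
          apply hf
          obtain ⟨v, rfl⟩ := hw
          fin_cases i
          · exact ⟨_, (hX v).symm⟩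
          · exact ⟨_, (hY v).symm⟩ }
  let φ : (κ → F) →ₗ[F] U :=
    { toFun := fun v => ⟨E v, ⟨v, rfl⟩⟩
      map_add' := fun v w => Subtype.ext (map_add E v w)
      map_smul' := fun a v => Subtype.ext (map_smul E a v) }
  have hφ : Function.Bijective φ := by
    refine ⟨fun v w h => embed_injective N.succ_pos S T (congrArg Subtype.val h), ?_⟩
    rintro ⟨_, v, rfl⟩
    exact ⟨v, rfl⟩
  let e : (κ → F) ≃ₗ[F] U := LinearEquiv.ofBijective φ hφ
  let b : Module.Basis κ F U := (Pi.basisFun F κ).map e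
  have key : ∀ (M : Matrix κ κ F) (j : κ), e (M.mulVec (Pi.single j 1)) = ∑ i, M i j • b i := by
    intro M j
    have : M.mulVec (Pi.single j 1) = ∑ i, M i j • Pi.basisFun F κ i := by
      ext k
      simp [Finset.sum_apply, Pi.single_apply]
    rw [this, map_sum]
    simp [b]
  refine ⟨⟨U, Module.Finite.of_basis b⟩, b, fun j => ⟨?_, ?_⟩⟩
  · rw [← key]
    refine Subtype.ext ?_
    change (X 0 : PolyXY F) • ((b j : U) : UniversalModule F) = E _
    rw [← hX]
    simp [b, e, φ]
  · rw [← key]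
    refine Subtype.ext ?_
    change (X 1 : PolyXY F) • ((b j : U) : UniversalModule F) = E _
    rw [← hY]
    simp [b, e, φ]

end Embedding

/-! ### Modules represented by the block matrices -/

section Frame

variable {F : Type u} [Field F]

/-- The value of the normal form coefficient at a matrix pair. -/
def coeffAt (p : MatrixPair F) (c m : ℕ × ℕ) : Matrix (Fin p.size) (Fin p.size) F :=
  FreeAlgebra.lift F ![p.fst, p.snd] (normalForm F c m)

theorem coeffAt_of_mem (p : MatrixPair F) (c : ℕ × ℕ) {m : ℕ × ℕ} (hm : m ∈ basisMonomials) :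
    coeffAt p c m = if m = c then 1 else 0 := by
  rw [coeffAt, normalForm_of_mem c hm]
  split_ifs <;> simp

theorem coeffAt_eq_zero_of_degree (p : MatrixPair F) {c : ℕ × ℕ} (hc : c ∈ basisMonomials)
    {m : ℕ × ℕ} (hm : 7 ≤ m.1 + m.2) : coeffAt p c m = 0 := by
  rw [coeffAt, normalForm_eq_zero_of_degree hc hm, map_zero]

theorem coeffAt_of_ne (p : MatrixPair F) {c m : ℕ × ℕ} (hc : c ≠ (1, 5)) (h : m ≠ c) :
    coeffAt p c m = 0 := by
  rw [coeffAt, normalForm_of_ne hc h, map_zero]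

theorem sum_coeffAt_mul (p : MatrixPair F) (c : Fin numBlocks) (m s : ℕ × ℕ)
    (hs : 1 ≤ s.1 + s.2) :
    ∑ c', coeffAt p (mon c) (mon c' + s) * coeffAt p (mon c') m = coeffAt p (mon c) (m + s) := by
  simp only [coeffAt, ← map_mul, ← map_sum]
  rw [sum_normalForm_mul c m s hs]

/-- A frame identifies the module `U` with the one that the block matrices of the pair `p` define:
with `V = F ^ p.size`, the map `gen m` sends `v : V` to `x ^ m.1 * y ^ m.2` times the generator
`gen (0, 0) v`, and `proj c` is the `V`-valued coordinate in the block `c`. -/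
structure Frame (p : MatrixPair F) (U : Type v) [AddCommGroup U] [Module F U]
    [Module (PolyXY F) U] where
  /-- The multiples of the generators. -/
  gen : ℕ × ℕ → (Fin p.size → F) →ₗ[F] U
  /-- The coordinates. -/
  proj : Fin numBlocks → U →ₗ[F] (Fin p.size → F)
  X_zero_smul_gen : ∀ m v, (X 0 : PolyXY F) • gen m v = gen (m + (1, 0)) v
  X_one_smul_gen : ∀ m v, (X 1 : PolyXY F) • gen m v = gen (m + (0, 1)) v
  proj_gen : ∀ c m v, proj c (gen m v) = (coeffAt p (mon c) m).mulVec v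
  sum_gen_proj : ∀ w, ∑ c, gen (mon c) (proj c w) = w

variable {U : Type v} [AddCommGroup U] [Module F U] {p : MatrixPair F}

/-- The map from `F ^ p.size` onto the span of the basis vectors of a block. -/
def blockIncl (b : Module.Basis (Fin numBlocks × Fin p.size) F U) (c : Fin numBlocks) :
    (Fin p.size → F) →ₗ[F] U :=
  Fintype.linearCombination F fun k => b (c, k)

theorem repr_blockIncl (b : Module.Basis (Fin numBlocks × Fin p.size) F U)
    (c c' : Fin numBlocks) (v : Fin p.size → F) (k : Fin p.size) :
    b.repr (blockIncl b c v) (c', k) = if c = c' then v k else 0 := by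
  classical
  rw [blockIncl, Fintype.linearCombination_apply, map_sum, Finset.sum_apply']
  simp [Finsupp.single_apply, ite_and]

/-- The maps `gen` of the frame attached to a basis. -/
def basisGen (b : Module.Basis (Fin numBlocks × Fin p.size) F U) (m : ℕ × ℕ) :
    (Fin p.size → F) →ₗ[F] U :=
  ∑ c, (blockIncl b c).comp (coeffAt p (mon c) m).mulVecLin

theorem basisGen_apply (b : Module.Basis (Fin numBlocks × Fin p.size) F U) (m : ℕ × ℕ)
    (v : Fin p.size → F) :
    basisGen b m v = ∑ c, blockIncl b c ((coeffAt p (mon c) m).mulVec v) := by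
  simp [basisGen]

theorem basisGen_mon (b : Module.Basis (Fin numBlocks × Fin p.size) F U) (c : Fin numBlocks)
    (v : Fin p.size → F) : basisGen b (mon c) v = blockIncl b c v := by
  rw [basisGen_apply, Finset.sum_eq_single c]
  · simp [coeffAt_of_mem p _ (mon_mem c)]
  · intro c' _ hc'
    rw [coeffAt_of_mem p _ (mon_mem c), if_neg fun h => hc' (mon_injective h).symm]
    simp
  · simp

variable [Module (PolyXY F) U]

theorem smul_basisGen [IsScalarTower F (PolyXY F) U]
    {b : Module.Basis (Fin numBlocks × Fin p.size) F U} {f : PolyXY F}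
    {s : ℕ × ℕ} (hs : 1 ≤ s.1 + s.2)
    (hb : ∀ j, f • b j = ∑ i, evalAt (mulMatrix F s) p i j • b i)
    (m : ℕ × ℕ) (v : Fin p.size → F) : f • basisGen b m v = basisGen b (m + s) v := by
  have hincl : ∀ (c : Fin numBlocks) (v : Fin p.size → F),
      f • blockIncl b c v = basisGen b (mon c + s) v := by
    intro c v
    rw [blockIncl, Fintype.linearCombination_apply, Finset.smul_sum]
    simp only [smul_comm f, hb, Fintype.sum_prod_type, basisGen_apply, blockIncl,
      Fintype.linearCombination_apply, Matrix.mulVec, dotProduct, Finset.sum_smul,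
      Finset.smul_sum, smul_smul]
    rw [Finset.sum_comm]
    refine Finset.sum_congr rfl fun c' _ => ?_
    rw [Finset.sum_comm]
    refine Finset.sum_congr rfl fun k _ => Finset.sum_congr rfl fun k' _ => ?_
    rw [mul_comm]
    rfl
  rw [basisGen_apply, Finset.smul_sum]
  simp only [hincl]
  simp only [basisGen_apply, Matrix.mulVec_mulVec]
  rw [Finset.sum_comm]
  refine Finset.sum_congr rfl fun c _ => ?_
  rw [← map_sum, ← sum_coeffAt_mul p c m s hs, Matrix.sum_mulVec]

/-- A module represented by the block matrices of `p` has a frame. -/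
theorem nonempty_frame [IsScalarTower F (PolyXY F) U]
    (b : Module.Basis (Fin numBlocks × Fin p.size) F U)
    (hX : ∀ j, (X 0 : PolyXY F) • b j = ∑ i, evalAt (mulMatrix F (1, 0)) p i j • b i)
    (hY : ∀ j, (X 1 : PolyXY F) • b j = ∑ i, evalAt (mulMatrix F (0, 1)) p i j • b i) :
    Nonempty (Frame p U) :=
  ⟨{ gen := basisGen b
     proj := fun c => LinearMap.pi fun k => b.coord (c, k)
     X_zero_smul_gen := smul_basisGen (by simp) hX
     X_one_smul_gen := smul_basisGen (by simp) hY
     proj_gen := fun c m v => by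
       ext k
       simp [basisGen_apply, repr_blockIncl]
     sum_gen_proj := fun w => by
       conv_rhs => rw [← b.sum_repr w]
       rw [Fintype.sum_prod_type]
       simp [basisGen_mon, blockIncl, Fintype.linearCombination_apply] }⟩

namespace Frame

variable (Φ : Frame p U)

theorem ext_proj {w w' : U} (h : ∀ c, Φ.proj c w = Φ.proj c w') : w = w' := by
  rw [← Φ.sum_gen_proj w, ← Φ.sum_gen_proj w']
  simp only [h]

theorem proj_gen_self {c : Fin numBlocks} {m : ℕ × ℕ} (h : m = mon c) (v : Fin p.size → F) :
    Φ.proj c (Φ.gen m v) = v := by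
  rw [Φ.proj_gen, h, coeffAt_of_mem p _ (mon_mem c), if_pos rfl, Matrix.one_mulVec]

end Frame

end Frame

/-! ### Relations in a framed module -/

namespace Frame

variable {F : Type u} [Field F] {p : MatrixPair F} {U : Type v} [AddCommGroup U] [Module F U]
  [Module (PolyXY F) U] (Φ : Frame p U)

theorem gen_eq_zero_of_degree {m : ℕ × ℕ} (hm : 7 ≤ m.1 + m.2) (v : Fin p.size → F) :
    Φ.gen m v = 0 := by
  refine Φ.ext_proj fun c => ?_
  rw [Φ.proj_gen, coeffAt_eq_zero_of_degree p (mon_mem c) hm, Matrix.zero_mulVec, map_zero]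

theorem gen_five_one (v : Fin p.size → F) : Φ.gen (5, 1) v = 0 := by
  refine Φ.ext_proj fun c => ?_
  rw [Φ.proj_gen, coeffAt, normalForm_five_one (mon_mem c), map_zero, Matrix.zero_mulVec, map_zero]

theorem gen_two_four (v : Fin p.size → F) : Φ.gen (2, 4) v = Φ.gen (1, 5) v := by
  refine Φ.ext_proj fun c => ?_
  have h : (2, 4) ≠ mon c := fun h => by simpa [← h, mem_basisMonomials] using mon_mem c
  rw [Φ.proj_gen, Φ.proj_gen]
  by_cases hc : (1, 5) = mon c
  · simp [coeffAt, normalForm, ← hc]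
  · simp [coeffAt, normalForm, h, hc, Ne.symm hc]

theorem gen_three_three (v : Fin p.size → F) :
    Φ.gen (3, 3) v = Φ.gen (1, 5) (p.fst.mulVec v) := by
  refine Φ.ext_proj fun c => ?_
  have h : (3, 3) ≠ mon c := fun h => by simpa [← h, mem_basisMonomials] using mon_mem c
  rw [Φ.proj_gen, Φ.proj_gen]
  by_cases hc : (1, 5) = mon c
  · simp [coeffAt, normalForm, ← hc]
  · simp [coeffAt, normalForm, h, hc, Ne.symm hc]

theorem gen_four_two (v : Fin p.size → F) :
    Φ.gen (4, 2) v = Φ.gen (1, 5) (p.snd.mulVec v) := by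
  refine Φ.ext_proj fun c => ?_
  have h : (4, 2) ≠ mon c := fun h => by simpa [← h, mem_basisMonomials] using mon_mem c
  rw [Φ.proj_gen, Φ.proj_gen]
  by_cases hc : (1, 5) = mon c
  · simp [coeffAt, normalForm, ← hc]
  · simp [coeffAt, normalForm, h, hc, Ne.symm hc]

theorem X_zero_smul_eq (w : U) :
    (X 0 : PolyXY F) • w = ∑ c, Φ.gen (mon c + (1, 0)) (Φ.proj c w) := by
  conv_lhs => rw [← Φ.sum_gen_proj w, Finset.smul_sum]
  simp only [Φ.X_zero_smul_gen]

theorem X_one_smul_eq (w : U) :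
    (X 1 : PolyXY F) • w = ∑ c, Φ.gen (mon c + (0, 1)) (Φ.proj c w) := by
  conv_lhs => rw [← Φ.sum_gen_proj w, Finset.smul_sum]
  simp only [Φ.X_one_smul_gen]

/-- The coordinate of a basis monomial not divisible by `x` vanishes on the multiples of `x`. -/
theorem proj_X_zero_smul {c : Fin numBlocks} (hc : (mon c).1 = 0) (w : U) :
    Φ.proj c ((X 0 : PolyXY F) • w) = 0 := by
  rw [Φ.X_zero_smul_eq, map_sum]
  refine Finset.sum_eq_zero fun c' _ => ?_
  rw [Φ.proj_gen, coeffAt_of_ne p (by rintro h; simp [h] at hc) (by rintro h; simp [← h] at hc),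
    Matrix.zero_mulVec]

theorem proj_X_one_smul {c : Fin numBlocks} (hc : (mon c).2 = 0) (w : U) :
    Φ.proj c ((X 1 : PolyXY F) • w) = 0 := by
  rw [Φ.X_one_smul_eq, map_sum]
  refine Finset.sum_eq_zero fun c' _ => ?_
  rw [Φ.proj_gen, coeffAt_of_ne p (by rintro h; simp [h] at hc) (by rintro h; simp [← h] at hc),
    Matrix.zero_mulVec]

theorem monomial_smul_gen (i j : ℕ) (m : ℕ × ℕ) (v : Fin p.size → F) :
    (X 0 ^ i * X 1 ^ j : PolyXY F) • Φ.gen m v = Φ.gen (m + (i, j)) v := by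
  have hX : ∀ i m, (X 0 ^ i : PolyXY F) • Φ.gen m v = Φ.gen (m + (i, 0)) v := by
    intro i
    induction i with
    | zero => simp
    | succ i ih =>
      intro m
      rw [pow_succ, mul_smul, Φ.X_zero_smul_gen, ih, add_assoc]
      simp [add_comm]
  have hY : ∀ j m, (X 1 ^ j : PolyXY F) • Φ.gen m v = Φ.gen (m + (0, j)) v := by
    intro j
    induction j with
    | zero => simp
    | succ j ih =>
      intro m
      rw [pow_succ, mul_smul, Φ.X_one_smul_gen, ih, add_assoc]
      simp [add_comm]
  rw [mul_smul, hY, hX, add_assoc]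
  simp

/-- Monomials of degree `6` see only the coordinate in the block of the constant monomial. -/
theorem monomial_smul_eq {i j : ℕ} (h : i + j = 6) (w : U) :
    (X 0 ^ i * X 1 ^ j : PolyXY F) • w = Φ.gen (i, j) (Φ.proj blkOne w) := by
  conv_lhs => rw [← Φ.sum_gen_proj w, Finset.smul_sum]
  simp only [Φ.monomial_smul_gen]
  rw [Finset.sum_eq_single blkOne]
  · simp
  · intro c _ hc
    refine Φ.gen_eq_zero_of_degree ?_ _
    have : mon c ≠ (0, 0) := fun h => hc (mon_injective (by simp [h]))
    have h2 : ¬ ((mon c).1 = 0 ∧ (mon c).2 = 0) := fun h => this (Prod.ext h.1 h.2)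
    simp only [Prod.fst_add, Prod.snd_add]
    omega
  · simp

variable [IsScalarTower F (PolyXY F) U]

/-- The coordinate of `x ^ 6` picks out the coefficient of `x ^ 6`. -/
theorem proj_blkX_smul (a b c d : F) (w : U) :
    Φ.proj blkX (((C a * X 0 + C b * X 1) ^ 5 * (C c * X 0 + C d * X 1) : PolyXY F) • w)
      = (a ^ 5 * c) • Φ.proj blkOne w := by
  -- Modulo `y` only the product of the `x` parts is left.
  obtain ⟨f, hf⟩ : (X 1 : PolyXY F) ∣ (C a * X 0 + C b * X 1) ^ 5 * (C c * X 0 + C d * X 1)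
      - C (a ^ 5 * c) * (X 0 ^ 6 * X 1 ^ 0) := by
    have h1 : (X 1 : PolyXY F) ∣ (C a * X 0 + C b * X 1) ^ 5 - (C a * X 0) ^ 5 :=
      (Dvd.intro (C b) (by ring)).trans (sub_dvd_pow_sub_pow _ _ 5)
    obtain ⟨f, hf⟩ := h1
    refine ⟨f * (C c * X 0 + C d * X 1) + (C a * X 0) ^ 5 * C d, ?_⟩
    rw [sub_eq_iff_eq_add] at hf
    rw [hf, map_mul, map_pow]
    ring
  rw [sub_eq_iff_eq_add] at hf
  rw [hf, add_smul, mul_smul, mul_smul, C_smul_eq, Φ.monomial_smul_eq rfl, map_add,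
    LinearMap.map_smul, Φ.proj_X_one_smul (by simp), Φ.proj_gen_self (by simp), zero_add]

/-- The coordinate of `y ^ 6` picks out the coefficient of `y ^ 6`. -/
theorem proj_blkY_smul (a b c d : F) (w : U) :
    Φ.proj blkY (((C a * X 0 + C b * X 1) ^ 5 * (C c * X 0 + C d * X 1) : PolyXY F) • w)
      = (b ^ 5 * d) • Φ.proj blkOne w := by
  obtain ⟨f, hf⟩ : (X 0 : PolyXY F) ∣ (C a * X 0 + C b * X 1) ^ 5 * (C c * X 0 + C d * X 1)
      - C (b ^ 5 * d) * (X 0 ^ 0 * X 1 ^ 6) := by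
    have h1 : (X 0 : PolyXY F) ∣ (C a * X 0 + C b * X 1) ^ 5 - (C b * X 1) ^ 5 :=
      (Dvd.intro (C a) (by ring)).trans (sub_dvd_pow_sub_pow _ _ 5)
    obtain ⟨f, hf⟩ := h1
    refine ⟨f * (C c * X 0 + C d * X 1) + (C b * X 1) ^ 5 * C c, ?_⟩
    rw [sub_eq_iff_eq_add] at hf
    rw [hf, map_mul, map_pow]
    ring
  rw [sub_eq_iff_eq_add] at hf
  rw [hf, add_smul, mul_smul, mul_smul, C_smul_eq, Φ.monomial_smul_eq rfl, map_add,
    LinearMap.map_smul, Φ.proj_X_zero_smul (by simp), Φ.proj_gen_self (by simp), zero_add]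

theorem diag_smul {a d : F} {i j : ℕ} (h : i + j = 6) (w : U) :
    ((C a * X 0) ^ i * (C d * X 1) ^ j : PolyXY F) • w
      = (a ^ i * d ^ j) • Φ.gen (i, j) (Φ.proj blkOne w) := by
  rw [← Φ.monomial_smul_eq h, ← C_smul_eq (a ^ i * d ^ j), ← mul_smul, map_mul, map_pow, map_pow]
  congr 1
  ring

end Frame

/-! ### Weak isomorphisms of framed modules -/

section Rigidity

variable {F : Type u} [Field F] {p q : MatrixPair F}
  {U : Type v} [AddCommGroup U] [Module F U] [Module (PolyXY F) U] [IsScalarTower F (PolyXY F) U]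
  {W : Type v} [AddCommGroup W] [Module F W] [Module (PolyXY F) W]

/-- The map that `φ` induces on generators, that is, on the quotients of the framed modules by the
multiples of `x` and `y`. -/
def genMap (Φ : Frame p U) (Ψ : Frame q W) (φ : W →ₗ[F] U) :
    (Fin q.size → F) →ₗ[F] (Fin p.size → F) :=
  (Φ.proj blkOne).comp (φ.comp (Ψ.gen (0, 0)))

variable {θ : PolyXY F ≃ₐ[F] PolyXY F} {φ : W →ₗ[F] U}

theorem proj_map (Φ : Frame p U) (Ψ : Frame q W) (hθ : IsLinearAut θ)
    (hφ : ∀ f w, φ (f • w) = θ f • φ w) (w : W) :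
    Φ.proj blkOne (φ w) = genMap Φ Ψ φ (Ψ.proj blkOne w) := by
  obtain ⟨α, -, hα⟩ := hθ
  have hX : ∀ (i : Fin 2) w, Φ.proj blkOne (φ ((X i : PolyXY F) • w)) = 0 := by
    intro i w
    rw [hφ, hα, add_smul, mul_smul, mul_smul, C_smul_eq, C_smul_eq, map_add, LinearMap.map_smul,
      LinearMap.map_smul,
      Φ.proj_X_zero_smul (by simp), Φ.proj_X_one_smul (by simp), smul_zero, smul_zero, add_zero]
  conv_lhs => rw [← Ψ.sum_gen_proj w]
  rw [map_sum, map_sum, Finset.sum_eq_single blkOne]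
  · simp [genMap]
  · intro c _ hc
    have hne : mon c ≠ (0, 0) := fun h => hc (mon_injective (by simp [h]))
    rcases hm : mon c with ⟨i, j⟩
    rw [hm] at hne
    rcases i with _ | i
    · rcases j with _ | j
      · exact absurd rfl hne
      · rw [show ((0, j + 1) : ℕ × ℕ) = (0, j) + (0, 1) from rfl, ← Ψ.X_one_smul_gen, hX]
    · rw [show ((i + 1, j) : ℕ × ℕ) = (i, j) + (1, 0) from rfl, ← Ψ.X_zero_smul_gen, hX]
  · simp

theorem genMap_surjective (Φ : Frame p U) (Ψ : Frame q W) (hθ : IsLinearAut θ)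
    (hφ : ∀ f w, φ (f • w) = θ f • φ w) (hs : Function.Surjective φ) :
    Function.Surjective (genMap Φ Ψ φ) := by
  intro v
  obtain ⟨w, hw⟩ := hs (Φ.gen (0, 0) v)
  refine ⟨Ψ.proj blkOne w, ?_⟩
  rw [← proj_map Φ Ψ hθ hφ, hw, Φ.proj_gen_self (by simp)]

/-- The relations `x ^ 5 * y = 0` and `x ^ 2 * y ^ 4 = x * y ^ 5` are compatible only with linear
automorphisms that are scalar. -/
theorem scalar_of_semilinear (Φ : Frame p U) (Ψ : Frame q W) (hθ : IsLinearAut θ)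
    (hφ : ∀ f w, φ (f • w) = θ f • φ w) {v : Fin q.size → F} (hv : genMap Φ Ψ φ v ≠ 0) :
    ∃ a : F, a ≠ 0 ∧ θ (X 0) = C a * X 0 ∧ θ (X 1) = C a * X 1 := by
  obtain ⟨α, hdet, hα⟩ := hθ
  rw [Matrix.det_fin_two] at hdet
  have hgen : ∀ i j, φ (Ψ.gen (i, j) v) = (θ (X 0) ^ i * θ (X 1) ^ j) • φ (Ψ.gen (0, 0) v) := by
    intro i j
    rw [← map_pow, ← map_pow, ← map_mul, ← hφ, Ψ.monomial_smul_gen]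
    simp
  have h51 := hgen 5 1
  rw [Ψ.gen_five_one, map_zero, pow_one, hα, hα] at h51
  have hx : α 0 0 ^ 5 * α 1 0 = 0 := by
    have h := Φ.proj_blkX_smul (α 0 0) (α 0 1) (α 1 0) (α 1 1) (φ (Ψ.gen (0, 0) v))
    rw [← h51, map_zero, eq_comm] at h
    exact (smul_eq_zero.1 h).resolve_right hv
  have hy : α 0 1 ^ 5 * α 1 1 = 0 := by
    have h := Φ.proj_blkY_smul (α 0 0) (α 0 1) (α 1 0) (α 1 1) (φ (Ψ.gen (0, 0) v))
    rw [← h51, map_zero, eq_comm] at h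
    exact (smul_eq_zero.1 h).resolve_right hv
  have h15 : Φ.gen (1, 5) (Φ.proj blkOne (φ (Ψ.gen (0, 0) v))) ≠ 0 := by
    intro h
    have h' := congrArg (Φ.proj blkXY) h
    rw [Φ.proj_gen_self (by simp), map_zero] at h'
    exact hv h'
  rcases eq_or_ne (α 1 0) 0 with h10 | h10
  · have h00 : α 0 0 ≠ 0 := fun h => hdet (by rw [h, h10]; ring)
    have h11 : α 1 1 ≠ 0 := fun h => hdet (by rw [h, h10]; ring)
    have h01 : α 0 1 = 0 := by simpa [h11] using hy
    have hX : θ (X 0) = C (α 0 0) * X 0 := by simp [hα, h01]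
    have hY : θ (X 1) = C (α 1 1) * X 1 := by simp [hα, h10]
    refine ⟨α 0 0, h00, hX, ?_⟩
    have h24 := hgen 2 4
    rw [Ψ.gen_two_four, hgen 1 5, hX, hY, Φ.diag_smul rfl, Φ.diag_smul rfl, Φ.gen_two_four] at h24
    have h := smul_left_injective F h15 h24
    have h' : α 0 0 * α 1 1 ^ 4 * (α 1 1 - α 0 0) = 0 := by linear_combination h
    have : α 1 1 = α 0 0 := by
      simpa [h00, h11, sub_eq_zero] using h'
    rw [hY, this]
  -- Otherwise `θ` interchanges the lines of `x` and `y`, but `x * y ^ 5` does not vanish.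
  · exfalso
    have h00 : α 0 0 = 0 := by simpa [h10] using hx
    have h01 : α 0 1 ≠ 0 := fun h => hdet (by rw [h, h00]; ring)
    have h11 : α 1 1 = 0 := by simpa [h01] using hy
    have h : ((C (α 0 0) * X 0 + C (α 0 1) * X 1) ^ 5 * (C (α 1 0) * X 0 + C (α 1 1) * X 1) :
        PolyXY F) = (C (α 1 0) * X 0) ^ 1 * (C (α 0 1) * X 1) ^ 5 := by
      rw [h00, h11, map_zero]
      ring
    rw [h, Φ.diag_smul rfl, eq_comm, smul_eq_zero] at h51
    exact h51.elim (by simp [h10, h01]) h15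

theorem genMap_mulVec (Φ : Frame p U) (Ψ : Frame q W) (hθ : IsLinearAut θ)
    (hφ : ∀ f w, φ (f • w) = θ f • φ w) (hinj : Function.Injective (genMap Φ Ψ φ))
    (v : Fin q.size → F) :
    genMap Φ Ψ φ (q.fst.mulVec v) = p.fst.mulVec (genMap Φ Ψ φ v) ∧
      genMap Φ Ψ φ (q.snd.mulVec v) = p.snd.mulVec (genMap Φ Ψ φ v) := by
  rcases eq_or_ne v 0 with rfl | hv
  · simp
  obtain ⟨a, ha, hX, hY⟩ := scalar_of_semilinear Φ Ψ hθ hφ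
    (v := v) (fun h => hv (hinj (h.trans (map_zero _).symm)))
  have hgen : ∀ i j, i + j = 6 → ∀ u,
      φ (Ψ.gen (i, j) u) = a ^ 6 • Φ.gen (i, j) (genMap Φ Ψ φ u) := by
    intro i j hij u
    have h : Ψ.gen (i, j) u = (X 0 ^ i * X 1 ^ j : PolyXY F) • Ψ.gen (0, 0) u := by
      rw [Ψ.monomial_smul_gen]
      simp
    rw [h, hφ, map_mul, map_pow, map_pow, hX, hY, Φ.diag_smul hij, ← pow_add, hij]
    rfl
  have key : ∀ u u', a ^ 6 • Φ.gen (1, 5) u = a ^ 6 • Φ.gen (1, 5) u' → u = u' := by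
    intro u u' h
    have h' := congrArg (Φ.proj blkXY) (smul_right_injective U (pow_ne_zero 6 ha) h)
    rwa [Φ.proj_gen_self (by simp), Φ.proj_gen_self (by simp)] at h'
  constructor
  · apply key
    rw [← hgen 1 5 rfl, ← Ψ.gen_three_three, hgen 3 3 rfl, Φ.gen_three_three]
  · apply key
    rw [← hgen 1 5 rfl, ← Ψ.gen_four_two, hgen 4 2 rfl, Φ.gen_four_two]

/-- Weakly isomorphic framed modules come from similar pairs. -/
theorem similarPairs_of_semilinear (Φ : Frame p U) (Ψ : Frame q W) (hθ : IsLinearAut θ)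
    (hφ : ∀ f w, φ (f • w) = θ f • φ w) (hs : Function.Surjective φ) (hpq : p.size = q.size) :
    SimilarPairs p q := by
  obtain ⟨n, A, B⟩ := p
  obtain ⟨n', A', B'⟩ := q
  obtain rfl : n = n' := hpq
  have hsurj := genMap_surjective Φ Ψ hθ hφ hs
  have hinj : Function.Injective (genMap Φ Ψ φ) := LinearMap.injective_iff_surjective.2 hsurj
  set g : (Fin n → F) →ₗ[F] (Fin n → F) := genMap Φ Ψ φ with hg
  have hmul := genMap_mulVec Φ Ψ hθ hφ hinj
  have hS : IsUnit (LinearMap.toMatrix' g) := by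
    rw [← Matrix.mulVec_injective_iff_isUnit]
    simpa [Function.Injective] using hinj
  have hdet := (Matrix.isUnit_iff_isUnit_det _).1 hS
  have hconj : ∀ M M' : Matrix (Fin n) (Fin n) F,
      (∀ v, g (M'.mulVec v) = M.mulVec (g v)) →
        M' = (LinearMap.toMatrix' g)⁻¹ * M * LinearMap.toMatrix' g := by
    intro M M' h
    have h' : LinearMap.toMatrix' g * M' = M * LinearMap.toMatrix' g := by
      apply Matrix.toLin'.injective
      refine LinearMap.ext fun v => ?_
      simp only [Matrix.toLin'_mul, Matrix.toLin'_toMatrix', LinearMap.comp_apply,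
        Matrix.toLin'_apply, h]
    rw [mul_assoc, ← h', Matrix.nonsing_inv_mul_cancel_left _ _ hdet]
  rw [hconj A A' fun v => (hmul v).1, hconj B B' fun v => (hmul v).2]
  exact .conj n A B _ hS

end Rigidity

/-! ### Similar pairs give isomorphic modules -/

section Converse

variable {F : Type u} [Field F]

/-- A matrix that intertwines two pairs intertwines all noncommutative polynomials in them. -/
theorem lift_mul_eq_mul_lift {n : ℕ} {A B A' B' S : Matrix (Fin n) (Fin n) F}
    (hA : A * S = S * A') (hB : B * S = S * B') (f : FreeAlgebra F (Fin 2)) :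
    FreeAlgebra.lift F ![A, B] f * S = S * FreeAlgebra.lift F ![A', B'] f := by
  induction f using FreeAlgebra.induction with
  | grade0 r =>
    rw [AlgHom.commutes, AlgHom.commutes]
    exact Algebra.commutes r S
  | grade1 i => fin_cases i <;> simp [hA, hB]
  | mul a b ha hb => rw [map_mul, map_mul, mul_assoc, hb, ← mul_assoc, ha, mul_assoc]
  | add a b ha hb => rw [map_add, map_add, add_mul, mul_add, ha, hb]

variable {U W : Type v} [AddCommGroup U] [Module F U] [Module (PolyXY F) U]
  [IsScalarTower F (PolyXY F) U] [AddCommGroup W] [Module F W] [Module (PolyXY F) W]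
  [IsScalarTower F (PolyXY F) W]

theorem nonempty_linearEquiv_of_conj {n : ℕ} {A B S : Matrix (Fin n) (Fin n) F} (hS : IsUnit S)
    (Φ : Frame ⟨n, A, B⟩ U) (Ψ : Frame ⟨n, S⁻¹ * A * S, S⁻¹ * B * S⟩ W) :
    Nonempty (W ≃ₗ[PolyXY F] U) := by
  have hdet := (Matrix.isUnit_iff_isUnit_det _).1 hS
  let ψ : W →ₗ[F] U := ∑ c, (Φ.gen (mon c)).comp (S.mulVecLin.comp (Ψ.proj c))
  let χ : U →ₗ[F] W := ∑ c, (Ψ.gen (mon c)).comp (S⁻¹.mulVecLin.comp (Φ.proj c))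
  have hψ : ∀ w, ψ w = ∑ c, Φ.gen (mon c) (S.mulVec (Ψ.proj c w)) := fun w => by simp [ψ]
  have hχ : ∀ w, χ w = ∑ c, Ψ.gen (mon c) (S⁻¹.mulVec (Φ.proj c w)) := fun w => by simp [χ]
  have hconj : ∀ M : Matrix (Fin n) (Fin n) F, M * S = S * (S⁻¹ * M * S) := fun M => by
    rw [mul_assoc S⁻¹, Matrix.mul_nonsing_inv_cancel_left _ _ hdet]
  have hcoeff : ∀ c m, S * coeffAt ⟨n, S⁻¹ * A * S, S⁻¹ * B * S⟩ c m
      = coeffAt ⟨n, A, B⟩ c m * S := fun c m =>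
    (lift_mul_eq_mul_lift (hconj A) (hconj B) _).symm
  have hgen : ∀ m v, ψ (Ψ.gen m v) = Φ.gen m (S.mulVec v) := by
    intro m v
    rw [hψ, ← Φ.sum_gen_proj (Φ.gen m (S.mulVec v))]
    refine Finset.sum_congr rfl fun c _ => ?_
    rw [Ψ.proj_gen, Φ.proj_gen, Matrix.mulVec_mulVec, Matrix.mulVec_mulVec, hcoeff]
  have hX : ∀ (i : Fin 2) w, ψ ((X i : PolyXY F) • w) = (X i : PolyXY F) • ψ w := by
    intro i w
    fin_cases i
    · change ψ ((X 0 : PolyXY F) • w) = (X 0 : PolyXY F) • ψ w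
      simp only [Ψ.X_zero_smul_eq, map_sum, hgen, hψ w, Finset.smul_sum, Φ.X_zero_smul_gen]
    · change ψ ((X 1 : PolyXY F) • w) = (X 1 : PolyXY F) • ψ w
      simp only [Ψ.X_one_smul_eq, map_sum, hgen, hψ w, Finset.smul_sum, Φ.X_one_smul_gen]
  have hinj : Function.LeftInverse χ ψ := by
    intro w
    have hproj : ∀ c, Φ.proj c (ψ w) = S.mulVec (Ψ.proj c w) := by
      intro c
      rw [hψ, map_sum, Finset.sum_eq_single c]
      · exact Φ.proj_gen_self rfl _
      · intro c' _ hc'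
        rw [Φ.proj_gen, coeffAt_of_mem _ _ (mon_mem c'), if_neg fun h => hc' (mon_injective h),
          Matrix.zero_mulVec]
      · simp
    simp only [hχ, hproj, Matrix.mulVec_mulVec, Matrix.nonsing_inv_mul _ hdet, Matrix.one_mulVec,
      Ψ.sum_gen_proj]
  have hsurj : Function.RightInverse χ ψ := by
    intro w
    simp only [hχ, map_sum, hgen, Matrix.mulVec_mulVec, Matrix.mul_nonsing_inv _ hdet,
      Matrix.one_mulVec, Φ.sum_gen_proj]
  refine ⟨{ ψ with map_smul' := fun f w => ?_, invFun := χ, left_inv := hinj, right_inv := hsurj }⟩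
  change ψ (f • w) = f • ψ w
  induction f using MvPolynomial.induction_on generalizing w with
  | C a => rw [C_smul_eq, C_smul_eq, map_smul]
  | add f g hf hg => rw [add_smul, map_add, hf, hg, add_smul]
  | mul_X f i hf => rw [mul_smul, hf, hX, mul_smul]

end Converse

theorem exists_finDimSubmodule (F : Type u) [Field F] [CharZero F] (p : MatrixPair F) :
    ∃ U : FinDimSubmodule F, U.HasMatrices (Fin numBlocks × Fin p.size)
      (evalAt (mulMatrix F (1, 0)) p) (evalAt (mulMatrix F (0, 1)) p) :=
  exists_hasMatrices (N := 6) (commute_evalAt_mulMatrix _ _ (by simp) (by simp) p)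
    (evalAt_mulMatrix_pow_seven _ (by simp) p) (evalAt_mulMatrix_pow_seven _ (by simp) p)

end WeakIsoWild

end

theorem corollary1 (F : Type*) [Field F] [CharZero F] :
    WeakIsoWild.IsWild (WeakIsoWild.weakIsoSetoid F)
      (fun U ι _ S T => WeakIsoWild.FinDimSubmodule.HasMatrices U ι S T) := by
  open WeakIsoWild in
  choose Φ hΦ using exists_finDimSubmodule F
  refine ⟨numBlocks, mulMatrix F (1, 0), mulMatrix F (0, 1), Φ, hΦ, fun p q => ?_⟩
  obtain ⟨b, hb⟩ := hΦ p
  obtain ⟨b', hb'⟩ := hΦ q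
  obtain ⟨P⟩ := nonempty_frame b (fun j => (hb j).1) (fun j => (hb j).2)
  obtain ⟨Q⟩ := nonempty_frame b' (fun j => (hb' j).1) (fun j => (hb' j).2)
  constructor
  · rintro ⟨θ, hθ, ⟨e⟩⟩
    let φ₀ : (Φ q).1 ≃+ (Φ p).1 := e.toAddEquiv.trans (toTwist θ (Φ p).1).symm
    have hφ₀ : ∀ (f : PolyXY F) (w : (Φ q).1), φ₀ (f • w) = θ f • φ₀ w := fun f w => by
      change (toTwist θ (Φ p).1).symm (e (f • w)) = θ f • (toTwist θ (Φ p).1).symm (e w)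
      rw [map_smul, toTwist_symm_smul]
    let φ : (Φ q).1 ≃ₗ[F] (Φ p).1 :=
      { φ₀ with
        map_smul' := fun a w => by
          refine (congrArg φ₀ (C_smul_eq a w).symm).trans ((hφ₀ _ _).trans ?_)
          rw [show θ (C a) = C a from θ.commutes a]
          exact C_smul_eq (U := (Φ p).1) a (φ₀ w) }
    refine similarPairs_of_semilinear (φ := φ.toLinearMap) P Q hθ hφ₀ φ.surjective ?_
    have h := φ.finrank_eq
    rw [Module.finrank_eq_card_basis b, Module.finrank_eq_card_basis b'] at h
    simp only [Fintype.card_prod, Fintype.card_fin] at h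
    exact (Nat.eq_of_mul_eq_mul_left blkOne.pos h).symm
  · intro h
    generalize Φ p = U at *
    generalize Φ q = W at *
    induction h with
    | conj n A B S hS =>
      obtain ⟨e⟩ := nonempty_linearEquiv_of_conj hS P Q
      exact ⟨AlgEquiv.refl, isLinearAut_refl,
        ⟨{ e.toAddEquiv.trans (toTwist AlgEquiv.refl U.1) with
            map_smul' := fun f w => map_smul e f w }⟩⟩
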